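/- Let $p$ be a prime and $n\ge 0$ an integer. Let $R=\mathbb{F}_p[x_1,\ldots,x_n]$ and let $$\mathbf{A}=\mathbb{F}_p\{x_1,\ldots,x_n,f\}/(x_ix_j-x_jx_i,\ x_i^pf \mid 1\le i,j\le n),$$ graded by $\deg x_i=\deg f=1$. All modules are left modules, and every $\mathbf{A}$-module is regarded as an $R$-module along $R\to\mathbf{A}$, $x_i\mapsto x_i$. For an $\mathbf{A}$-module $N$ let $$\mathcal{F}_{\mathbf A}(N)=\bigoplus_{v\in\{0,\ldots,p-1\}^n}N\varepsilon_v,$$ made into an $R$-module by $x_i\cdot(g\varepsilon_v)=g\varepsilon_{v+e_i}$ if $v_i<p-1$ and $x_i\cdot(g\varepsilon_v)=0$ if $v_i=p-1$, where $e_i$ is the $i$th standard basis vector. Let $\Theta_N:\mathcal{F}_{\mathbf A}(N)\to N$ be the $R$-linear map $g\varepsilon_v\mapsto x^vfg$, and let $K_N=\operatorname{Ker}\Theta_N$ and $C_N=\operatorname{Coker}\Theta_N$ be the structural kernel and the structural cokernel of $N$, as $R$-modules. **Theorem.** Let $N$ be a left $\mathbf{A}$-module. 1. If $N$ is finitely generated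 over $\mathbf{A}$, then $C_N$ is finitely generated over $R$. 2. If $N$ is finitely presented over $\mathbf{A}$, then $K_N$ has finite length over $R$. Suppose moreover that $N=\bigoplus_{i\in\mathbb{Z}}[N]_i$ is a graded $\mathbf{A}$-module whose components $[N]_i$ are finite-dimensional over $\mathbb{F}_p$ and satisfy $[N]_i=0$ for $i\ll 0$. Then: 3. $N$ is finitely generated over $\mathbf{A}$ if and only if $C_N$ is finitely generated over $R$. 4. The following are equivalent: (a) $N$ is finitely presented over $\mathbf{A}$; (b) $C_N$ is finitely generated over $R$ and $K_N$ has finite length over $R$; (c) $C_N$ and $K_N$ are both finitely generated over $R$. -/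

import Mathlib

namespace FrobGraded

/-! ### Evaluating polynomials at commuting elements of a noncommutative algebra -/

open scoped IsMulCommutative in
/-- For pairwise commuting elements `a i` of a (not necessarily commutative) `k`-algebra `S`, the
unique `k`-algebra map `k[x_i] → S` that sends `x_i` to `a i`. It is obtained by evaluating in the
commutative subalgebra generated by the `a i`. -/
noncomputable def evalComm (k : Type*) {σ S : Type*} [CommRing k] [Ring S] [Algebra k S]
    (a : σ → S) (h : ∀ i j, a i * a j = a j * a i) : MvPolynomial σ k →ₐ[k] S :=
  haveI : IsMulCommutative (Algebra.adjoin k (Set.range a)) :=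
    Algebra.isMulCommutative_adjoin k (by rintro _ ⟨i, rfl⟩ _ ⟨j, rfl⟩; exact h i j)
  (Algebra.adjoin k (Set.range a)).val.comp
    (MvPolynomial.aeval fun i => ⟨a i, Algebra.subset_adjoin ⟨i, rfl⟩⟩)

open scoped IsMulCommutative in
theorem evalComm_X (k : Type*) {σ S : Type*} [CommRing k] [Ring S] [Algebra k S]
    (a : σ → S) (h : ∀ i j, a i * a j = a j * a i) (i : σ) :
    evalComm k a h (MvPolynomial.X i) = a i := by
  have : IsMulCommutative (Algebra.adjoin k (Set.range a)) :=
    Algebra.isMulCommutative_adjoin k (by rintro _ ⟨i, rfl⟩ _ ⟨j, rfl⟩; exact h i j)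
  change ((MvPolynomial.aeval (R := k) (fun i => (⟨a i, Algebra.subset_adjoin ⟨i, rfl⟩⟩ :
    Algebra.adjoin k (Set.range a))) (MvPolynomial.X i) : Algebra.adjoin k (Set.range a)) : S) = a i
  rw [MvPolynomial.aeval_X]

/-! ### The rings `R` and `A` -/

/-- The polynomial ring `R = 𝔽_p[x_1, …, x_n]`. -/
abbrev R (p n : ℕ) : Type := MvPolynomial (Fin n) (ZMod p)

/-- The defining relations of `A` in the free algebra on the letters `some i` (for `x_i`) and
`none` (for `f`): the `x_i` commute with each other, and `x_i ^ p * f = 0`. -/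
inductive Rel (p n : ℕ) :
    FreeAlgebra (ZMod p) (Option (Fin n)) → FreeAlgebra (ZMod p) (Option (Fin n)) → Prop
  | comm (i j : Fin n) :
      Rel p n (FreeAlgebra.ι (ZMod p) (some i) * FreeAlgebra.ι (ZMod p) (some j))
        (FreeAlgebra.ι (ZMod p) (some j) * FreeAlgebra.ι (ZMod p) (some i))
  | pow_mul (i : Fin n) :
      Rel p n (FreeAlgebra.ι (ZMod p) (some i) ^ p * FreeAlgebra.ι (ZMod p) none) 0

/-- The ring `A = 𝔽_p{x_1, …, x_n, f} / (x_i x_j - x_j x_i, x_i ^ p f)`. -/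
abbrev A (p n : ℕ) : Type := RingQuot (Rel p n)

/-- The class in `A` of a letter: `some i` gives `x_i` and `none` gives `f`. -/
noncomputable def letter (p n : ℕ) (l : Option (Fin n)) : A p n :=
  RingQuot.mkAlgHom (ZMod p) (Rel p n) (FreeAlgebra.ι (ZMod p) l)

/-- The element `x_i` of `A`. -/
noncomputable def x (p n : ℕ) (i : Fin n) : A p n := letter p n (some i)

/-- The element `f` of `A`. -/
noncomputable def f (p n : ℕ) : A p n := letter p n none

theorem x_mul_x (p n : ℕ) (i j : Fin n) : x p n i * x p n j = x p n j * x p n i := by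
  simpa [x, letter] using RingQuot.mkAlgHom_rel (ZMod p) (Rel.comm (p := p) i j)

theorem x_pow_mul_f (p n : ℕ) (i : Fin n) : x p n i ^ p * f p n = 0 := by
  simpa [x, f, letter] using RingQuot.mkAlgHom_rel (ZMod p) (Rel.pow_mul (p := p) i)

/-- The component `[A]_d` of the grading of `A` in which every `x_i` and `f` have degree `1`: the
span of the words of length `d`. -/
noncomputable def gradeA (p n d : ℕ) : Submodule (ZMod p) (A p n) :=
  Submodule.span (ZMod p)
    {a | ∃ w : List (Option (Fin n)), w.length = d ∧ a = (w.map (letter p n)).prod}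

/-- The inclusion `R → A`, sending `x_i` to `x_i`. -/
noncomputable def incl (p n : ℕ) : R p n →ₐ[ZMod p] A p n :=
  evalComm (ZMod p) (x p n) (x_mul_x p n)

theorem incl_X (p n : ℕ) (i : Fin n) : incl p n (MvPolynomial.X i) = x p n i :=
  evalComm_X _ _ _ i

/-- The element `x^v f` of `A`. -/
noncomputable def xf (p n : ℕ) (v : Fin n → Fin p) : A p n :=
  incl p n (∏ i, MvPolynomial.X i ^ (v i : ℕ)) * f p n

/-! ### Graded modules -/

/-- `𝒩` is a grading of the left `A`-module `N`, indexed by the integers: `N` is the internal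
direct sum of the subspaces `𝒩 i = [N]_i`, and `[A]_d [N]_i ⊆ [N]_{d + i}`. -/
structure IsGradedModule (p n : ℕ) {N : Type*} [AddCommGroup N] [Module (ZMod p) N]
    [Module (A p n) N] (𝒩 : ℤ → Submodule (ZMod p) N) : Prop where
  isInternal : DirectSum.IsInternal 𝒩
  smul_mem : ∀ (d : ℕ) (i : ℤ), ∀ a ∈ gradeA p n d, ∀ m ∈ 𝒩 i, a • m ∈ 𝒩 (d + i)

/-! ### Restriction of scalars along `R → A` -/

/-- `N`, regarded as an `R`-module by restriction of scalars along the inclusion `R → A`. -/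
def Res (_p _n : ℕ) (N : Type*) : Type _ := N

instance (p n : ℕ) (N : Type*) [AddCommGroup N] : AddCommGroup (Res p n N) :=
  inferInstanceAs (AddCommGroup N)

noncomputable instance (p n : ℕ) (N : Type*) [AddCommGroup N] [Module (A p n) N] :
    Module (R p n) (Res p n N) :=
  Module.compHom N (incl p n : R p n →+* A p n)

/-! ### The functor `ℱ_A` and the structure morphism -/

/-- The direct sum `ℱ_A(N)` of copies `N ε_v` of `N`, over all `v ∈ {0, …, p - 1}^n`; the element
`g ε_v` is `Finsupp.single v g`. -/
def FA (p n : ℕ) (N : Type*) [AddCommGroup N] : Type _ := (Fin n → Fin p) →₀ N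

noncomputable instance (p n : ℕ) (N : Type*) [AddCommGroup N] : AddCommGroup (FA p n N) :=
  inferInstanceAs (AddCommGroup ((Fin n → Fin p) →₀ N))

/-- The operator `x_i` on `⨁_v N ε_v`: it sends `g ε_v` to `g ε_{v + e_i}` if `v_i < p - 1`, and
to `0` if `v_i = p - 1`. -/
noncomputable def shift (p n : ℕ) (N : Type*) [AddCommGroup N] [Module (ZMod p) N] (i : Fin n) :
    Module.End (ZMod p) ((Fin n → Fin p) →₀ N) :=
  Finsupp.lsum (ZMod p) fun v =>
    if h : (v i : ℕ) + 1 < p then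
      Finsupp.lsingle (Function.update v i ⟨(v i : ℕ) + 1, h⟩)
    else 0

theorem shift_single (p n : ℕ) (N : Type*) [AddCommGroup N] [Module (ZMod p) N] (i : Fin n)
    (v : Fin n → Fin p) (g : N) :
    shift p n N i (Finsupp.single v g) =
      if h : (v i : ℕ) + 1 < p then
        Finsupp.single (Function.update v i ⟨(v i : ℕ) + 1, h⟩) g
      else 0 := by
  unfold shift
  rw [Finsupp.lsum_single]
  split_ifs <;> simp

theorem shift_mul_shift (p n : ℕ) (N : Type*) [AddCommGroup N] [Module (ZMod p) N] (i j : Fin n) :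
    shift p n N i * shift p n N j = shift p n N j * shift p n N i := by
  rcases eq_or_ne i j with rfl | hij
  · rfl
  refine Finsupp.lhom_ext fun v g => ?_
  simp only [Module.End.mul_apply, shift_single]
  by_cases hi : (v i : ℕ) + 1 < p <;> by_cases hj : (v j : ℕ) + 1 < p <;>
    simp [hi, hj, shift_single, Function.update_of_ne hij, Function.update_of_ne hij.symm,
      Function.update_comm hij]

/-- The `R`-module structure of `ℱ_A(N)`, in which `x_i` acts by `shift p n N i`. -/
noncomputable instance (p n : ℕ) (N : Type*) [AddCommGroup N] [Module (ZMod p) N] :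
    Module (R p n) (FA p n N) :=
  Module.compHom ((Fin n → Fin p) →₀ N)
    (evalComm (ZMod p) (shift p n N) (shift_mul_shift p n N) :
      R p n →+* Module.End (ZMod p) ((Fin n → Fin p) →₀ N))

section Theta

variable (p n : ℕ) (N : Type*) [AddCommGroup N] [Module (ZMod p) N] [Module (A p n) N]
  [IsScalarTower (ZMod p) (A p n) N]

/-- The structure morphism as a map of vector spaces: it sends `g ε_v` to `x^v f g`. -/
noncomputable def thetaAux : ((Fin n → Fin p) →₀ N) →ₗ[ZMod p] N :=
  Finsupp.lsum (ZMod p) fun v => Algebra.lsmul (ZMod p) (ZMod p) N (xf p n v)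

theorem thetaAux_single (v : Fin n → Fin p) (g : N) :
    thetaAux p n N (Finsupp.single v g) = xf p n v • g := by
  unfold thetaAux
  rw [Finsupp.lsum_single]
  rfl

theorem x_mul_xf_of_lt (p n : ℕ) (i : Fin n) (v : Fin n → Fin p) (h : (v i : ℕ) + 1 < p) :
    x p n i * xf p n v = xf p n (Function.update v i ⟨(v i : ℕ) + 1, h⟩) := by
  unfold xf
  rw [← incl_X, ← mul_assoc, ← map_mul]
  congr 2
  rw [← Finset.mul_prod_erase Finset.univ _ (Finset.mem_univ i),
    ← Finset.mul_prod_erase Finset.univ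
      (fun j => (MvPolynomial.X j : R p n) ^ (Function.update v i ⟨(v i : ℕ) + 1, h⟩ j : ℕ))
      (Finset.mem_univ i), ← mul_assoc]
  congr 1
  · simp [pow_succ']
  · refine Finset.prod_congr rfl fun j hj => ?_
    rw [Function.update_of_ne (Finset.ne_of_mem_erase hj)]

theorem x_mul_xf_of_not_lt (p n : ℕ) (i : Fin n) (v : Fin n → Fin p) (h : ¬ (v i : ℕ) + 1 < p) :
    x p n i * xf p n v = 0 := by
  have hp : (v i : ℕ) + 1 = p := by have := (v i).2; omega
  unfold xf
  rw [← incl_X, ← mul_assoc, ← map_mul, ← Finset.mul_prod_erase Finset.univ _ (Finset.mem_univ i),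
    ← mul_assoc, ← pow_succ', hp, mul_comm, map_mul, mul_assoc, map_pow, incl_X, x_pow_mul_f,
    mul_zero]

theorem thetaAux_shift (i : Fin n) (m : (Fin n → Fin p) →₀ N) :
    thetaAux p n N (shift p n N i m) = x p n i • thetaAux p n N m := by
  induction m using Finsupp.induction_linear with
  | zero => simp
  | add a b ha hb => rw [map_add, map_add, map_add, ha, hb, smul_add]
  | single v g =>
    rw [shift_single, thetaAux_single, ← mul_smul]
    split_ifs with h
    · rw [thetaAux_single, x_mul_xf_of_lt p n i v h]
    · rw [x_mul_xf_of_not_lt p n i v h, map_zero, zero_smul]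

theorem thetaAux_smul (r : R p n) (m : (Fin n → Fin p) →₀ N) :
    thetaAux p n N (evalComm (ZMod p) (shift p n N) (shift_mul_shift p n N) r m) =
      incl p n r • thetaAux p n N m := by
  induction r using MvPolynomial.induction_on generalizing m with
  | C c =>
    have h1 := (evalComm (ZMod p) (shift p n N) (shift_mul_shift p n N)).commutes c
    have h2 := (incl p n).commutes c
    rw [MvPolynomial.algebraMap_eq] at h1 h2
    rw [h1, h2, Module.algebraMap_end_apply, map_smul, algebraMap_smul]
  | add a b ha hb => rw [map_add, map_add, LinearMap.add_apply, map_add, ha, hb, add_smul]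
  | mul_X a i ha =>
    rw [map_mul, map_mul, Module.End.mul_apply, ha, evalComm_X, incl_X, thetaAux_shift, mul_smul]

/-- The structure morphism `Θ_N : ℱ_A(N) → N`, the `R`-linear map that sends `g ε_v` to
`x^v f g`. -/
noncomputable def theta : FA p n N →ₗ[R p n] Res p n N where
  toFun := thetaAux p n N
  map_add' := map_add (thetaAux p n N)
  map_smul' := thetaAux_smul p n N

/-- The structural kernel `K_N = Ker Θ_N`, an `R`-module. -/
abbrev K : Type _ := LinearMap.ker (theta p n N)

/-- The structural cokernel `C_N = Coker Θ_N`, an `R`-module. -/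
abbrev C : Type _ := Res p n N ⧸ LinearMap.range (theta p n N)

end Theta

end FrobGraded

namespace FrobGraded

/-! ### Generators of `A` and actions of `A` -/

/-! As an `R`-module, `A` is `R ⊕ Θ(ℱ(A))` with `Θ_A` injective: every element is a polynomial plus
a combination of the `x^v f a` (`exists_eq_incl_add`), and letting `A` act on a model of `R ⊕ ℱ(A)`
recovers the coefficients (`thetaAux_A_injective`). Hence a finitely generated module has a finitely
generated structural cokernel.

Let `l : M → N` be surjective with kernel `L`, where `M` is free of finite rank. As `ℱ` is exact and
`K_M = 0`, the snake lemma gives an exact sequence `0 → K_N → C_L → C_M`. Since `R` is Noetherian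
and `C_M` is finitely generated, `K_N` is finitely generated exactly when `C_L` is (`ker_theta_fg`
uses `L.FG` to obtain `C_L`; `cokerSub_ker_fg` is the converse). A finitely generated submodule of
`ℱ(N)` is even a finite set (`finite_of_fg_FA`), which gives finite length.

In the graded case `Θ` raises degrees, so a graded Nakayama argument (`fg_of_cokerSub_fg`) passes
from `C_L` to `L` when degrees are bounded below. It is applied to `N` itself and to the kernel of a
graded free cover. -/

theorem A_induction {p n : ℕ} {P : A p n → Prop} (one : P 1)
    (letter_mul : ∀ l a, P a → P (letter p n l * a)) (add : ∀ a b, P a → P b → P (a + b))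
    (smul : ∀ (c : ZMod p) a, P a → P (c • a)) (a : A p n) : P a := by
  obtain ⟨b, rfl⟩ := RingQuot.mkAlgHom_surjective (ZMod p) (Rel p n) a
  -- Generalizing from `b` to left multiplication by `b` makes the product case a composition.
  suffices h : ∀ a, P a → P (RingQuot.mkAlgHom (ZMod p) (Rel p n) b * a) by
    simpa using h 1 one
  induction b using FreeAlgebra.induction with
  | grade0 c =>
    intro a ha
    rw [AlgHom.commutes, ← Algebra.smul_def]
    exact smul c a ha
  | grade1 l => exact letter_mul l
  | mul b c hb hc =>
    intro a ha
    rw [map_mul, mul_assoc]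
    exact hb _ (hc a ha)
  | add b c hb hc =>
    intro a ha
    rw [map_add, add_mul]
    exact add _ _ (hb a ha) (hc a ha)

/-- The action of `A` on a vector space defined by commuting operators `op (some i)` and an
operator `op none` with `op (some i) ^ p * op none = 0`. -/
noncomputable def liftEnd {p n : ℕ} {V : Type*} [AddCommGroup V] [Module (ZMod p) V]
    (op : Option (Fin n) → Module.End (ZMod p) V)
    (comm : ∀ i j, op (some i) * op (some j) = op (some j) * op (some i))
    (pow_mul : ∀ i, op (some i) ^ p * op none = 0) : A p n →ₐ[ZMod p] Module.End (ZMod p) V :=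
  RingQuot.liftAlgHom (ZMod p) ⟨FreeAlgebra.lift (ZMod p) op, by
    rintro _ _ (⟨i, j⟩ | i)
    · simpa using comm i j
    · simpa using pow_mul i⟩

theorem liftEnd_letter {p n : ℕ} {V : Type*} [AddCommGroup V] [Module (ZMod p) V]
    (op : Option (Fin n) → Module.End (ZMod p) V)
    (comm : ∀ i j, op (some i) * op (some j) = op (some j) * op (some i))
    (pow_mul : ∀ i, op (some i) ^ p * op none = 0) (l : Option (Fin n)) :
    liftEnd op comm pow_mul (letter p n l) = op l := by
  simp [liftEnd, letter]

/-! ### The functor `ℱ_A` -/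

theorem shift_pow_single {p n : ℕ} {N : Type*} [AddCommGroup N] [Module (ZMod p) N] (i : Fin n)
    (k : ℕ) (v : Fin n → Fin p) (g : N) :
    (shift p n N i ^ k) (Finsupp.single v g) =
      if h : (v i : ℕ) + k < p then
        Finsupp.single (Function.update v i ⟨(v i : ℕ) + k, h⟩) g
      else 0 := by
  induction k generalizing v with
  | zero => simp
  | succ k ih =>
    rw [pow_succ, Module.End.mul_apply, shift_single]
    by_cases h : (v i : ℕ) + 1 < p
    · rw [dif_pos h, ih]
      simp [add_assoc, add_comm 1 k]
    · rw [dif_neg h, map_zero, dif_neg (by omega)]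

theorem shift_pow_eq_zero {p n : ℕ} {N : Type*} [AddCommGroup N] [Module (ZMod p) N]
    (i : Fin n) : shift p n N i ^ p = 0 := by
  refine Finsupp.lhom_ext fun v g => ?_
  rw [shift_pow_single, dif_neg (by omega), LinearMap.zero_apply]

/-- Adjoin the variables one at a time: a coordinate not yet treated is `0`, so raising it by `v i <
p` never overflows. -/
theorem evalComm_shift_monomial {p n : ℕ} [NeZero p] {N : Type*} [AddCommGroup N]
    [Module (ZMod p) N] (v : Fin n → Fin p) (g : N) :
    evalComm (ZMod p) (shift p n N) (shift_mul_shift p n N)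
      (∏ i, MvPolynomial.X i ^ (v i : ℕ)) (Finsupp.single 0 g) = Finsupp.single v g := by
  suffices h : ∀ s : Finset (Fin n), evalComm (ZMod p) (shift p n N) (shift_mul_shift p n N)
      (∏ i ∈ s, MvPolynomial.X i ^ (v i : ℕ)) (Finsupp.single 0 g) =
        Finsupp.single (fun i => if i ∈ s then v i else 0) g by
    simpa using h Finset.univ
  intro s
  induction s using Finset.induction_on with
  | empty => simp; rfl
  | insert i s hi ih =>
    rw [Finset.prod_insert hi, map_mul, Module.End.mul_apply, ih, map_pow, evalComm_X,
      shift_pow_single, dif_pos (by simp [hi])]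
    congr 1
    ext j
    rcases eq_or_ne j i with rfl | hj
    · simp [hi]
    · simp [hj]

section Module

variable {p n : ℕ} {N : Type*} [AddCommGroup N] [Module (ZMod p) N] [Module (A p n) N]
  [IsScalarTower (ZMod p) (A p n) N]

theorem thetaAux_apply (φ : (Fin n → Fin p) →₀ N) : thetaAux p n N φ = ∑ v, xf p n v • φ v := by
  rw [thetaAux, Finsupp.lsum_apply, Finsupp.sum_fintype _ _ (by simp)]
  rfl

end Module

/-! ### The structure of `A` as an `R`-module -/

section Structure

variable {p n : ℕ}

/-- The sum `R + Θ(ℱ(A))` contains `1` and is stable under left multiplication by letters: `f * a`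
is `Θ(a ε_0)`, and `x_i` acts compatibly on both summands. -/
theorem exists_eq_incl_add [NeZero p] (a : A p n) :
    ∃ (r : R p n) (φ : (Fin n → Fin p) →₀ A p n), a = incl p n r + thetaAux p n (A p n) φ := by
  induction a using A_induction with
  | one => exact ⟨1, 0, by simp⟩
  | letter_mul l a ha =>
    cases l with
    | none => exact ⟨0, Finsupp.single 0 a, by rw [thetaAux_single]; simp [xf, f]⟩
    | some i =>
      obtain ⟨r, φ, h⟩ := ha
      refine ⟨MvPolynomial.X i * r, shift p n (A p n) i φ, ?_⟩
      rw [thetaAux_shift, map_mul, incl_X, h, mul_add]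
      rfl
  | add a b ha hb =>
    obtain ⟨r, φ, rfl⟩ := ha
    obtain ⟨s, ψ, rfl⟩ := hb
    exact ⟨r + s, φ + ψ, by rw [map_add, map_add]; exact add_add_add_comm _ _ _ _⟩
  | smul c a ha =>
    obtain ⟨r, φ, rfl⟩ := ha
    exact ⟨c • r, c • φ, by rw [map_smul, map_smul, smul_add]⟩

/-- The operators by which the letters act on `R ⊕ ℱ_A(A)`, transported from the left
multiplications on `A` along `(r, φ) ↦ r + Θ_A φ`. -/
noncomputable def splitOp (p n : ℕ) [NeZero p] :
    Option (Fin n) → Module.End (ZMod p) (R p n × ((Fin n → Fin p) →₀ A p n))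
  | some i => (LinearMap.mulLeft (ZMod p) (MvPolynomial.X i)).prodMap (shift p n (A p n) i)
  | none => (LinearMap.inr (ZMod p) _ _).comp ((Finsupp.lsingle 0).comp
      ((incl p n).toLinearMap.coprod (thetaAux p n (A p n))))

theorem splitOp_some_pow [NeZero p] (i : Fin n) (k : ℕ)
    (e : R p n × ((Fin n → Fin p) →₀ A p n)) : (splitOp p n (some i) ^ k) e =
      (MvPolynomial.X i ^ k * e.1, (shift p n (A p n) i ^ k) e.2) := by
  induction k with
  | zero => simp
  | succ k ih =>
    rw [pow_succ', Module.End.mul_apply, ih, pow_succ', mul_assoc, pow_succ', Module.End.mul_apply]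
    rfl

/-- The `A`-module structure of `R ⊕ ℱ_A(A)`. -/
noncomputable def splitHom (p n : ℕ) [NeZero p] :
    A p n →ₐ[ZMod p] Module.End (ZMod p) (R p n × ((Fin n → Fin p) →₀ A p n)) :=
  liftEnd (splitOp p n)
    (fun i j => LinearMap.ext fun e => Prod.ext (mul_left_comm _ _ _)
      (LinearMap.congr_fun (shift_mul_shift p n (A p n) i j) e.2))
    (fun i => LinearMap.ext fun e => by
      rw [Module.End.mul_apply, splitOp_some_pow, shift_pow_eq_zero]
      simp [splitOp])

/-- It is enough to check letters, whose operators were chosen to make `(r, φ) ↦ r + Θ φ` linear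
over `A`. -/
theorem coprod_splitHom [NeZero p] (a : A p n) (e : R p n × ((Fin n → Fin p) →₀ A p n)) :
    (incl p n).toLinearMap.coprod (thetaAux p n (A p n)) (splitHom p n a e) =
      a * (incl p n).toLinearMap.coprod (thetaAux p n (A p n)) e := by
  induction a using A_induction with
  | one => simp
  | letter_mul l a ha =>
    rw [map_mul, Module.End.mul_apply, mul_assoc, ← ha, splitHom, liftEnd_letter, ← splitHom]
    generalize splitHom p n a e = e
    cases l with
    | none =>
      simp only [splitOp, LinearMap.comp_apply, LinearMap.inr_apply, LinearMap.coprod_apply,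
        map_zero, zero_add, Finsupp.lsingle_apply, thetaAux_single]
      simp [xf, f]
    | some i =>
      simp only [splitOp, LinearMap.prodMap_apply, LinearMap.coprod_apply, thetaAux_shift,
        LinearMap.mulLeft_apply, AlgHom.toLinearMap_apply, map_mul, incl_X, mul_add]
      rfl
  | add a b ha hb => rw [map_add, LinearMap.add_apply, map_add, ha, hb, add_mul]
  | smul c a ha => rw [map_smul, LinearMap.smul_apply, map_smul, ha, smul_mul_assoc]

theorem splitHom_incl [NeZero p] (r : R p n) (φ : (Fin n → Fin p) →₀ A p n) :
    splitHom p n (incl p n r) (0, φ) =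
      (0, evalComm (ZMod p) (shift p n (A p n)) (shift_mul_shift p n (A p n)) r φ) := by
  induction r using MvPolynomial.induction_on generalizing φ with
  | C c =>
    rw [← MvPolynomial.algebraMap_eq, AlgHom.commutes, AlgHom.commutes, AlgHom.commutes]
    simp [Module.algebraMap_end_apply]
  | add a b ha hb => simp [ha, hb]
  | mul_X a i ha =>
    rw [map_mul, map_mul, map_mul, Module.End.mul_apply, Module.End.mul_apply, incl_X, evalComm_X,
      x, splitHom, liftEnd_letter, ← splitHom, ← ha]
    simp [splitOp]

/-- By `coprod_splitHom`, `a • (1, 0)` has image `a` in `A`, so `f` sends it to `a ε_0`; then `x^v`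
moves `ε_0` to `ε_v`. -/
theorem splitHom_xf [NeZero p] (v : Fin n → Fin p) (a : A p n) :
    splitHom p n (xf p n v * a) (1, 0) = (0, Finsupp.single v a) := by
  have h : splitHom p n (f p n) (splitHom p n a (1, 0)) = (0, Finsupp.single 0 a) := by
    have h1 := coprod_splitHom a (1, 0)
    rw [f, splitHom, liftEnd_letter, ← splitHom]
    simp only [splitOp, LinearMap.comp_apply, h1]
    simp
  rw [xf, map_mul, map_mul, Module.End.mul_apply, Module.End.mul_apply, h, splitHom_incl,
    evalComm_shift_monomial]

/-- Acting on `(1, 0)` and taking the second component is a left inverse of `Θ_A`. -/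
theorem thetaAux_A_injective [NeZero p] : Function.Injective (thetaAux p n (A p n)) := by
  have h : ∀ φ, splitHom p n (thetaAux p n (A p n) φ) (1, 0) = (0, φ) := fun φ => by
    induction φ using Finsupp.induction_linear with
    | zero => simp; rfl
    | add a b ha hb => simp [ha, hb]
    | single v a => rw [thetaAux_single, smul_eq_mul, splitHom_xf]
  intro φ ψ hφψ
  have := h φ
  rw [hφψ, h ψ] at this
  exact (Prod.ext_iff.1 this).2.symm

theorem thetaAux_pi_injective [NeZero p] (ι : Type*) :
    Function.Injective (thetaAux p n (ι → A p n)) := by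
  refine (injective_iff_map_eq_zero _).2 fun φ hφ => ?_
  rw [thetaAux_apply] at hφ
  refine Finsupp.ext fun v => funext fun j => ?_
  have h : thetaAux p n (A p n) (Finsupp.mapRange (fun g : ι → A p n => g j) rfl φ) = 0 := by
    rw [thetaAux_apply]
    refine Eq.trans ?_ (congrFun hφ j)
    simp
  have := (injective_iff_map_eq_zero (thetaAux p n (A p n))).1 thetaAux_A_injective _ h
  simpa using DFunLike.congr_fun this v

end Structure

/-! ### Finite generation up to kernels -/

/-- On `W` the map `h` factors through `g`. This replaces the connecting map of the snake lemma:
`K_N` and its counterpart in `C_L` are two images of one submodule of `ℱ(M)`. -/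
theorem fg_map_of_ker_le {S M M₁ M₂ : Type*} [Ring S] [AddCommGroup M] [AddCommGroup M₁]
    [AddCommGroup M₂] [Module S M] [Module S M₁] [Module S M₂] {g : M →ₗ[S] M₁} {h : M →ₗ[S] M₂}
    (hgh : LinearMap.ker g ≤ LinearMap.ker h) {W : Submodule S M} (hW : (W.map g).FG) :
    (W.map h).FG := by
  classical
  obtain ⟨t, ht⟩ := hW
  have hsub : (t : Set M₁) ⊆ g '' W := by
    rw [← Submodule.map_coe, ← ht]
    exact Submodule.subset_span
  obtain ⟨u, huW, rfl⟩ := Finset.subset_set_image_iff.1 hsub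
  rw [Finset.coe_image, Submodule.span_image] at ht
  refine ⟨u.image h, ?_⟩
  rw [Finset.coe_image, Submodule.span_image]
  refine le_antisymm (Submodule.map_mono (Submodule.span_le.2 huW)) ?_
  rw [LinearMap.map_le_map_iff]
  exact ((LinearMap.map_le_map_iff g).1 ht.ge).trans (sup_le_sup_left hgh _)

/-! ### Submodules of `ℱ(N)` and functoriality -/

section Sub

variable {p n : ℕ} {N : Type*} [AddCommGroup N] [Module (ZMod p) N]

/-- Scalars in `ZMod p` preserve every additive subgroup, so only the variables need checking. -/
theorem FA_smul_mem {V : AddSubgroup ((Fin n → Fin p) →₀ N)}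
    (hV : ∀ i, ∀ φ ∈ V, shift p n N i φ ∈ V) (r : R p n) :
    ∀ φ ∈ V, evalComm (ZMod p) (shift p n N) (shift_mul_shift p n N) r φ ∈ V := by
  induction r using MvPolynomial.induction_on with
  | C c =>
    intro φ hφ
    rw [← MvPolynomial.algebraMap_eq, AlgHom.commutes, Module.algebraMap_end_apply]
    exact ZMod.smul_mem hφ c
  | add a b ha hb =>
    intro φ hφ
    rw [map_add, LinearMap.add_apply]
    exact V.add_mem (ha φ hφ) (hb φ hφ)
  | mul_X a i ha =>
    intro φ hφ
    rw [map_mul, Module.End.mul_apply, evalComm_X]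
    exact ha _ (hV i φ hφ)

theorem shift_mem {V : AddSubgroup N} (i : Fin n) {φ : (Fin n → Fin p) →₀ N} (hφ : ∀ v, φ v ∈ V)
    (w : Fin n → Fin p) : shift p n N i φ w ∈ V := by
  rw [shift, Finsupp.lsum_apply, Finsupp.sum_fintype _ _ (by simp), Finsupp.finsetSum_apply]
  refine V.sum_mem fun v _ => ?_
  split_ifs with h
  · rw [Finsupp.lsingle_apply, Finsupp.single_apply]
    split_ifs
    · exact hφ v
    · exact V.zero_mem
  · exact V.zero_mem

/-- The submodule `ℱ(V) = ⨁_v V ε_v` of `⨁_v N ε_v`. -/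
noncomputable def FASub (n : ℕ) (V : AddSubgroup N) : Submodule (R p n) (FA p n N) where
  carrier := {φ : (Fin n → Fin p) →₀ N | ∀ v, φ v ∈ V}
  add_mem' hφ hψ v := V.add_mem (hφ v) (hψ v)
  zero_mem' _ := V.zero_mem
  smul_mem' r φ := FA_smul_mem (V :=
    { carrier := {φ : (Fin n → Fin p) →₀ N | ∀ v, φ v ∈ V}
      add_mem' := fun hφ hψ v => V.add_mem (hφ v) (hψ v)
      zero_mem' := fun _ => V.zero_mem
      neg_mem' := fun hφ v => V.neg_mem (hφ v) }) (fun i _ hφ => shift_mem i hφ) r φ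

theorem finite_FASub {V : AddSubgroup N} [Finite V] : Finite (FASub (p := p) n V) := by
  refine Finite.of_injective (β := (Fin n → Fin p) → V) (fun φ v => ⟨_, φ.2 v⟩) ?_
  intro φ ψ h
  refine Subtype.ext (Finsupp.ext fun v => ?_)
  exact congrArg Subtype.val (congrFun h v)

/-- The operators `x_i` only move coefficients between positions. Hence `W` lies in `ℱ(V)`, where
`V` is the finite-dimensional span of the coefficients of the generators. -/
theorem finite_of_fg_FA [NeZero p] {W : Submodule (R p n) (FA p n N)} (hW : W.FG) : Finite W := by
  classical
  obtain ⟨t, rfl⟩ := hW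
  let V : Submodule (ZMod p) N := Submodule.span (ZMod p)
    (⋃ φ ∈ t, Set.range (id φ : (Fin n → Fin p) →₀ N))
  have hfin : Module.Finite (ZMod p) V := Module.Finite.span_of_finite (ZMod p)
    (t.finite_toSet.biUnion fun φ _ => Set.finite_range _)
  have : Finite V := Module.finite_of_finite (ZMod p)
  have : Finite V.toAddSubgroup := this
  have := finite_FASub (p := p) (n := n) (V := V.toAddSubgroup)
  refine Finite.of_injective _ (Submodule.inclusion_injective (p' := FASub n V.toAddSubgroup)
    (Submodule.span_le.2 fun φ hφ v => ?_))
  exact Submodule.subset_span (Set.mem_biUnion hφ ⟨v, rfl⟩)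

variable {M : Type*} [AddCommGroup M] [Module (ZMod p) M]

theorem mapRange_evalComm_shift (l : M →ₗ[ZMod p] N) (r : R p n) (φ : (Fin n → Fin p) →₀ M) :
    Finsupp.mapRange.linearMap l
      (evalComm (ZMod p) (shift p n M) (shift_mul_shift p n M) r φ) =
      evalComm (ZMod p) (shift p n N) (shift_mul_shift p n N) r
        (Finsupp.mapRange.linearMap l φ) := by
  induction r using MvPolynomial.induction_on generalizing φ with
  | C c =>
    rw [← MvPolynomial.algebraMap_eq, AlgHom.commutes, AlgHom.commutes,
      Module.algebraMap_end_apply, Module.algebraMap_end_apply, map_smul]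
  | add a b ha hb => simp only [map_add, LinearMap.add_apply, ha, hb]
  | mul_X a i ha =>
    rw [map_mul, map_mul, Module.End.mul_apply, Module.End.mul_apply, ha, evalComm_X, evalComm_X]
    congr 1
    induction φ using Finsupp.induction_linear with
    | zero => simp
    | add a b ha hb => simp only [map_add, ha, hb]
    | single v g =>
      simp only [Finsupp.mapRange.linearMap_apply, Finsupp.mapRange_single, shift_single]
      split_ifs <;> simp

/-- The functor `ℱ_A` on maps. -/
noncomputable def FAMap (n : ℕ) (l : M →ₗ[ZMod p] N) : FA p n M →ₗ[R p n] FA p n N where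
  toFun := Finsupp.mapRange.linearMap (α := Fin n → Fin p) l
  map_add' := map_add (Finsupp.mapRange.linearMap (α := Fin n → Fin p) l)
  map_smul' := mapRange_evalComm_shift l

theorem mem_ker_FAMap {l : M →ₗ[ZMod p] N} {φ : FA p n M} :
    φ ∈ LinearMap.ker (FAMap n l) ↔ φ ∈ FASub n (LinearMap.ker l).toAddSubgroup :=
  Finsupp.ext_iff

theorem FAMap_surjective {l : M →ₗ[ZMod p] N} (hl : Function.Surjective l) :
    Function.Surjective (FAMap n l) :=
  Finsupp.mapRange_surjective l (map_zero l) hl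

end Sub

/-! ### Structural cokernels of submodules and the snake lemma -/

section Cokernel

variable {p n : ℕ} {M : Type*} [AddCommGroup M] [Module (ZMod p) M] [Module (A p n) M]
  [IsScalarTower (ZMod p) (A p n) M]

/-- An `A`-submodule, regarded as an `R`-submodule. -/
def resSub (L : Submodule (A p n) M) : Submodule (R p n) (Res p n M) where
  carrier := (L : Set M)
  add_mem' := L.add_mem
  zero_mem' := L.zero_mem
  smul_mem' r _ := L.smul_mem (incl p n r)

/-- The image of `ℱ_A(L)` under the structure morphism, for a submodule `L` of `M`. -/
noncomputable def imageTheta (L : Submodule (A p n) M) : Submodule (R p n) (Res p n M) :=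
  (FASub n L.toAddSubgroup).map (theta p n M)

/-- The structural cokernel of the submodule `L`, as a submodule of a quotient of the ambient
module. -/
noncomputable def cokerSub (L : Submodule (A p n) M) :
    Submodule (R p n) (Res p n M ⧸ imageTheta L) :=
  (resSub L).map (imageTheta L).mkQ

theorem sum_mem_imageTheta {L : Submodule (A p n) M} {φ : (Fin n → Fin p) → M}
    (hφ : ∀ v, φ v ∈ L) : (∑ v, xf p n v • φ v : M) ∈ imageTheta L :=
  ⟨(Finsupp.equivFunOnFinite.symm φ : (Fin n → Fin p) →₀ M), hφ, thetaAux_apply (N := M) _⟩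

theorem exists_of_mem_imageTheta {L : Submodule (A p n) M} {m : Res p n M}
    (hm : m ∈ imageTheta L) :
    ∃ φ : (Fin n → Fin p) → M, (∀ v, φ v ∈ L) ∧ m = (∑ v, xf p n v • φ v : M) := by
  obtain ⟨φ, hφ, rfl⟩ := hm
  exact ⟨(id φ : (Fin n → Fin p) →₀ M), hφ, thetaAux_apply (N := M) _⟩

theorem imageTheta_top : imageTheta (⊤ : Submodule (A p n) M) = LinearMap.range (theta p n M) := by
  have : FASub (p := p) n (⊤ : Submodule (A p n) M).toAddSubgroup = ⊤ :=
    Submodule.eq_top_iff'.2 fun _ _ => trivial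
  rw [imageTheta, this, Submodule.map_top]

theorem cokerSub_top_fg_iff :
    (cokerSub (⊤ : Submodule (A p n) M)).FG ↔ Module.Finite (R p n) (C p n M) := by
  have : resSub (⊤ : Submodule (A p n) M) = ⊤ := rfl
  rw [cokerSub, this, imageTheta_top, Submodule.map_top, Submodule.range_mkQ, Module.finite_def]

/-- Split each scalar as in `exists_eq_incl_add`: the polynomial part preserves the right-hand side,
and the rest lands in `Θ(ℱ(L))`. -/
theorem resSub_span_le [NeZero p] (s : Set M) : resSub (Submodule.span (A p n) s) ≤
    Submodule.span (R p n) (M := Res p n M) s ⊔ imageTheta (Submodule.span (A p n) s) := by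
  intro m hm
  induction hm using Submodule.span_induction with
  | mem m hm => exact Submodule.mem_sup_left (Submodule.subset_span hm)
  | zero => exact Submodule.zero_mem _
  | add a b _ _ ha hb => exact Submodule.add_mem _ ha hb
  | smul a m hm ih =>
    obtain ⟨r, φ, rfl⟩ := exists_eq_incl_add a
    have h : (incl p n r + thetaAux p n (A p n) φ) • (id m : M) =
        incl p n r • (id m : M) + ∑ v, xf p n v • φ v • (id m : M) := by
      simp_rw [add_smul, thetaAux_apply, Finset.sum_smul, smul_eq_mul, mul_smul]
    refine Set.mem_of_eq_of_mem h (Submodule.add_mem _ (Submodule.smul_mem _ r ih)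
      (Submodule.mem_sup_right ?_))
    exact sum_mem_imageTheta (M := M) fun v => Submodule.smul_mem _ _ hm

theorem cokerSub_fg [NeZero p] {L : Submodule (A p n) M} [IsNoetherianRing (R p n)]
    (hL : L.FG) : (cokerSub L).FG := by
  obtain ⟨s, rfl⟩ := hL
  refine Submodule.FG.of_le (T := (Submodule.span (R p n) (M := Res p n M) (s : Set M)).map
    (imageTheta (Submodule.span (A p n) (s : Set M))).mkQ)
    ((Submodule.fg_span (M := Res p n M) s.finite_toSet).map _) ((LinearMap.map_le_map_iff _).2 ?_)
  rw [Submodule.ker_mkQ]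
  exact resSub_span_le _

theorem exists_finite_of_cokerSub_fg {L : Submodule (A p n) M} (hL : (cokerSub L).FG) :
    ∃ s : Finset M, (∀ m ∈ s, m ∈ L) ∧ ∀ m ∈ L, ∃ u ∈ Submodule.span (A p n) (s : Set M),
      ∃ φ : (Fin n → Fin p) → M, (∀ v, φ v ∈ L) ∧ m = u + ∑ v, xf p n v • φ v := by
  classical
  obtain ⟨t, ht⟩ := hL
  have hsub : (t : Set (Res p n M ⧸ imageTheta L)) ⊆ (imageTheta L).mkQ '' (resSub L) := by
    rw [← Submodule.map_coe, ← cokerSub, ← ht]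
    exact Submodule.subset_span
  obtain ⟨u, huL, rfl⟩ := Finset.subset_set_image_iff.1 hsub
  rw [Finset.coe_image, Submodule.span_image, cokerSub] at ht
  refine ⟨u, huL, fun m hm => ?_⟩
  have h := (LinearMap.map_le_map_iff _).1 ht.ge (show m ∈ resSub L from hm)
  rw [Submodule.ker_mkQ] at h
  obtain ⟨y, hy, z, hz, rfl⟩ := Submodule.mem_sup.1 h
  obtain ⟨φ, hφ, rfl⟩ := exists_of_mem_imageTheta hz
  refine ⟨y, ?_, φ, hφ, rfl⟩
  have : Submodule.span (R p n) (u : Set (Res p n M)) ≤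
      resSub (Submodule.span (A p n) (M := M) (u : Set (Res p n M))) :=
    Submodule.span_le.2 (Submodule.subset_span (R := A p n) (M := M))
  exact this hy

variable {N : Type*} [AddCommGroup N] [Module (ZMod p) N] [Module (A p n) N]
  [IsScalarTower (ZMod p) (A p n) N]

theorem theta_FAMap (l : M →ₗ[A p n] N) (φ : FA p n M) :
    theta p n N (FAMap n (l.restrictScalars (ZMod p)) φ) = l (theta p n M φ) := by
  refine (thetaAux_apply (N := N) _).trans (Eq.trans ?_ (congrArg l (thetaAux_apply _)).symm)
  rw [map_sum]
  refine Finset.sum_congr rfl fun v _ => ?_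
  rw [map_smul]
  rfl

/-- Lift an element of `ℱ(N)` to `ℱ(M)`; by naturality of `Θ`, it lies in `K_N` exactly when `Θ_M`
sends the lift into `ker l`. -/
theorem ker_theta_eq_map {l : M →ₗ[A p n] N} (hl : Function.Surjective l) :
    LinearMap.ker (theta p n N) = ((resSub (LinearMap.ker l)).comap (theta p n M)).map
      (FAMap n (l.restrictScalars (ZMod p))) := by
  ext ψ
  constructor
  · intro hψ
    obtain ⟨φ, rfl⟩ := FAMap_surjective (n := n) (l := l.restrictScalars (ZMod p)) hl ψ
    exact ⟨φ, (theta_FAMap l φ).symm.trans hψ, rfl⟩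
  · rintro ⟨φ, hφ, rfl⟩
    exact (theta_FAMap l φ).trans hφ

theorem ker_theta_fg [IsNoetherianRing (R p n)] {l : M →ₗ[A p n] N} (hl : Function.Surjective l)
    (hinj : Function.Injective (theta p n M)) (hL : (LinearMap.ker l).FG) [NeZero p] :
    (LinearMap.ker (theta p n N)).FG := by
  rw [ker_theta_eq_map hl]
  refine fg_map_of_ker_le (g := (imageTheta (LinearMap.ker l)).mkQ.comp (theta p n M)) ?_ ?_
  -- Injectivity of `Θ_M` enters only here: `Θ_M φ ∈ Θ_M(ℱ(L))` forces `φ ∈ ℱ(L)`.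
  · intro φ hφ
    rw [LinearMap.mem_ker, LinearMap.comp_apply, ← LinearMap.mem_ker, Submodule.ker_mkQ] at hφ
    obtain ⟨ψ, hψ, h⟩ := hφ
    rw [← hinj h]
    exact mem_ker_FAMap.2 hψ
  · rw [Submodule.map_comp]
    exact (cokerSub_fg hL).of_le (Submodule.map_mono (Submodule.map_comap_le _ _))

theorem cokerSub_ker_fg [IsNoetherianRing (R p n)] [NeZero p] [Module.Finite (A p n) M]
    {l : M →ₗ[A p n] N} (hl : Function.Surjective l) (hK : (LinearMap.ker (theta p n N)).FG) :
    (cokerSub (LinearMap.ker l)).FG := by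
  have hC : Module.Finite (R p n) (C p n M) :=
    cokerSub_top_fg_iff.1 (cokerSub_fg Module.Finite.fg_top)
  have hle : imageTheta (LinearMap.ker l) ≤ LinearMap.range (theta p n M) :=
    LinearMap.map_le_range
  -- Exactness at `C_L`: its image in the Noetherian module `C_M` is finitely generated, and a class
  -- that dies in `C_M` is represented by some `Θ_M φ ∈ L`, hence comes from `K_N`.
  refine Submodule.fg_of_fg_map_of_fg_inf_ker (Submodule.factor hle)
    (IsNoetherian.noetherian _) ?_
  rw [ker_theta_eq_map hl] at hK
  have h := fg_map_of_ker_le (h := (imageTheta (LinearMap.ker l)).mkQ.comp (theta p n M)) ?_ hK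
  · refine h.of_le ?_
    rintro _ ⟨⟨m, hm, rfl⟩, hm'⟩
    rw [SetLike.mem_coe, LinearMap.mem_ker, Submodule.mkQ_apply] at hm'
    obtain ⟨φ, rfl⟩ := (Submodule.Quotient.mk_eq_zero (LinearMap.range (theta p n M))).1 hm'
    exact ⟨φ, hm, rfl⟩
  · intro φ hφ
    rw [LinearMap.mem_ker, LinearMap.comp_apply, ← LinearMap.mem_ker, Submodule.ker_mkQ]
    exact ⟨φ, mem_ker_FAMap.1 hφ, rfl⟩

end Cokernel

/-! ### Gradings given by projections -/

/-- A `ℤ`-grading of an `A`-module, given by its projections onto the components. -/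
structure Projections (p n : ℕ) (M : Type*) [AddCommGroup M] [Module (A p n) M] where
  /-- The projection onto the component of degree `i`. -/
  proj : ℤ → M →+ M
  exists_sum_eq : ∀ m, ∃ s : Finset ℤ, ∀ t, s ⊆ t → ∑ i ∈ t, proj i m = m
  proj_proj : ∀ i j m, proj i (proj j m) = if i = j then proj j m else 0
  proj_letter : ∀ l i m, proj (i + 1) (letter p n l • m) = letter p n l • proj i m

/-! ### The grading of `A` -/

section GradingA

variable {p n : ℕ}

/-- The action of `A` on sequences in `A` in which a letter acts by multiplication and a shift. -/
noncomputable def shiftHom (p n : ℕ) : A p n →ₐ[ZMod p] Module.End (ZMod p) (ℤ → A p n) :=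
  let op (l : Option (Fin n)) : Module.End (ZMod p) (ℤ → A p n) :=
    { toFun := fun g i => letter p n l * g (i - 1)
      map_add' := fun g h => funext fun i => mul_add _ _ _
      map_smul' := fun c g => funext fun i => mul_smul_comm c (letter p n l) (g (i - 1)) }
  have op_pow (l : Option (Fin n)) (k : ℕ) (g : ℤ → A p n) (i : ℤ) :
      (op l ^ k) g i = letter p n l ^ k * g (i - k) := by
    induction k generalizing i with
    | zero => simp
    | succ k ih =>
      rw [pow_succ', Module.End.mul_apply]
      change letter p n l * (op l ^ k) g (i - 1) = _
      rw [ih, pow_succ', mul_assoc, Nat.cast_succ, sub_sub, add_comm (1 : ℤ)]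
  liftEnd op
    (fun i j => LinearMap.ext fun g => funext fun d => by
      change x p n i * (x p n j * _) = x p n j * (x p n i * _)
      rw [← mul_assoc, ← mul_assoc, x_mul_x])
    (fun i => LinearMap.ext fun g => funext fun d => by
      rw [Module.End.mul_apply, op_pow]
      change x p n i ^ p * (f p n * _) = 0
      rw [← mul_assoc, x_pow_mul_f, zero_mul])

theorem shiftHom_letter (l : Option (Fin n)) (g : ℤ → A p n) (i : ℤ) :
    shiftHom p n (letter p n l) g (i + 1) = letter p n l * g i := by
  rw [shiftHom, liftEnd_letter]
  change letter p n l * g (i + 1 - 1) = _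
  rw [add_sub_cancel_right]

/-- The projection of `A` onto its component of degree `i`. -/
noncomputable def projA (p n : ℕ) (i : ℤ) : A p n →+ A p n where
  toFun a := shiftHom p n a (Pi.single 0 1) i
  map_zero' := by simp
  map_add' a b := by simp

theorem projA_one (i : ℤ) : projA p n i 1 = if i = 0 then 1 else 0 := by
  change shiftHom p n 1 (Pi.single 0 1) i = _
  rw [map_one, Module.End.one_apply, Pi.single_apply]

theorem projA_smul (i : ℤ) (c : ZMod p) (a : A p n) :
    projA p n i (c • a) = c • projA p n i a := by
  change shiftHom p n (c • a) _ _ = _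
  rw [map_smul]
  rfl

theorem projA_letter_mul (l : Option (Fin n)) (i : ℤ) (a : A p n) :
    projA p n (i + 1) (letter p n l * a) = letter p n l * projA p n i a := by
  change shiftHom p n _ _ _ = _
  rw [map_mul, Module.End.mul_apply, shiftHom_letter]
  rfl

theorem projA_letter_mul' (l : Option (Fin n)) (i : ℤ) (a : A p n) :
    projA p n i (letter p n l * a) = letter p n l * projA p n (i - 1) a := by
  rw [← projA_letter_mul, sub_add_cancel]

theorem projA_of_neg {i : ℤ} (hi : i < 0) (a : A p n) : projA p n i a = 0 := by
  induction a using A_induction generalizing i with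
  | one => rw [projA_one, if_neg hi.ne]
  | letter_mul l a ha => rw [projA_letter_mul', ha (by omega), mul_zero]
  | add a b ha hb => rw [map_add, ha hi, hb hi, add_zero]
  | smul c a ha => rw [projA_smul, ha hi, smul_zero]

theorem projA_projA (i j : ℤ) (a : A p n) :
    projA p n i (projA p n j a) = if i = j then projA p n j a else 0 := by
  induction a using A_induction generalizing i j with
  | one =>
    rw [projA_one]
    split_ifs <;> simp_all [projA_one]
  | letter_mul l a ha =>
    rw [projA_letter_mul', projA_letter_mul', ha]
    simp only [sub_left_inj]
    split_ifs <;> simp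
  | add a b ha hb =>
    rw [map_add, map_add, ha, hb]
    split_ifs <;> simp
  | smul c a ha =>
    rw [projA_smul, projA_smul, ha]
    split_ifs <;> simp

theorem exists_sum_projA_eq (a : A p n) :
    ∃ s : Finset ℤ, ∀ t, s ⊆ t → ∑ i ∈ t, projA p n i a = a := by
  induction a using A_induction with
  | one =>
    refine ⟨{0}, fun t ht => ?_⟩
    simp_rw [projA_one]
    rw [Finset.sum_ite_eq', if_pos (ht (Finset.mem_singleton_self 0))]
  | letter_mul l a ha =>
    obtain ⟨s, hs⟩ := ha
    refine ⟨s.map (Equiv.addRight (1 : ℤ)).toEmbedding, fun t ht => ?_⟩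
    simp_rw [projA_letter_mul', ← Finset.mul_sum]
    congr 1
    refine Eq.trans ?_ (hs (t.map (Equiv.subRight (1 : ℤ)).toEmbedding) fun i hi => ?_)
    · rw [Finset.sum_map]
      rfl
    · have := ht (Finset.mem_map_of_mem _ hi)
      exact Finset.mem_map.2 ⟨i + 1, this, add_sub_cancel_right i 1⟩
  | add a b ha hb =>
    obtain ⟨s, hs⟩ := ha
    obtain ⟨s', hs'⟩ := hb
    -- Quantifying over all larger `t` lets the union serve both summands.
    refine ⟨s ∪ s', fun t ht => ?_⟩
    simp_rw [map_add, Finset.sum_add_distrib]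
    rw [hs t (Finset.union_subset_left ht), hs' t (Finset.union_subset_right ht)]
  | smul c a ha =>
    obtain ⟨s, hs⟩ := ha
    refine ⟨s, fun t ht => ?_⟩
    simp_rw [projA_smul, ← Finset.smul_sum]
    rw [hs t ht]

/-- The grading of the free module with basis elements of degrees `d j`. -/
noncomputable def projectionsPi {ι : Type*} [Fintype ι] (d : ι → ℤ) :
    Projections p n (ι → A p n) where
  proj i :=
    { toFun := fun a j => projA p n (i - d j) (a j)
      map_zero' := funext fun j => map_zero _
      map_add' := fun a b => funext fun j => map_add _ _ _ }
  exists_sum_eq a := by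
    choose s hs using fun j => exists_sum_projA_eq (a j)
    refine ⟨Finset.univ.biUnion fun j => (s j).map (Equiv.addRight (d j)).toEmbedding,
      fun t ht => funext fun j => ?_⟩
    rw [Finset.sum_apply]
    refine Eq.trans ?_ (hs j (t.map (Equiv.subRight (d j)).toEmbedding) fun i hi => ?_)
    · rw [Finset.sum_map]
      rfl
    · have := ht (Finset.mem_biUnion.2 ⟨j, Finset.mem_univ j, Finset.mem_map_of_mem _ hi⟩)
      exact Finset.mem_map.2 ⟨i + d j, this, add_sub_cancel_right i (d j)⟩
  proj_proj i i' a := by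
    refine funext fun j => ?_
    change projA p n (i - d j) (projA p n (i' - d j) (a j)) = _
    rw [projA_projA]
    simp only [sub_left_inj]
    split_ifs <;> rfl
  proj_letter l i a := by
    refine funext fun j => ?_
    change projA p n (i + 1 - d j) (letter p n l * a j) = _
    rw [add_sub_right_comm, projA_letter_mul]
    rfl

end GradingA

/-! ### Homogeneous elements and graded Nakayama -/

namespace Projections

variable {p n : ℕ} {M : Type*} [AddCommGroup M] [Module (A p n) M]
  (G : Projections p n M)

theorem finite_support (m : M) : {i | G.proj i m ≠ 0}.Finite := by
  obtain ⟨s, hs⟩ := G.exists_sum_eq m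
  refine s.finite_toSet.subset fun i hi => ?_
  by_contra his
  refine hi ?_
  rw [← hs s subset_rfl, map_sum]
  refine Finset.sum_eq_zero fun j hj => ?_
  rw [G.proj_proj, if_neg]
  rintro rfl
  exact his hj

theorem mem_of_forall_proj_mem {V : Submodule (A p n) M} {m : M} (h : ∀ i, G.proj i m ∈ V) :
    m ∈ V := by
  obtain ⟨s, hs⟩ := G.exists_sum_eq m
  rw [← hs s subset_rfl]
  exact V.sum_mem fun i _ => h i

/-- The element `x^v f` is homogeneous; only the positivity of its degree `k + 1` is needed, so `k`
stays unspecified. -/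
theorem exists_proj_xf_smul (v : Fin n → Fin p) :
    ∃ k : ℕ, ∀ i (m : M), G.proj (i + k + 1) (xf p n v • m) = xf p n v • G.proj i m := by
  let T : Submonoid (R p n) :=
    { carrier := {r | ∃ k : ℕ, ∀ i (m : M),
        G.proj (i + k) (incl p n r • m) = incl p n r • G.proj i m}
      one_mem' := ⟨0, by simp⟩
      mul_mem' := by
        rintro r r' ⟨k, hk⟩ ⟨k', hk'⟩
        refine ⟨k' + k, fun i m => ?_⟩
        rw [map_mul, mul_smul, mul_smul, ← hk', ← hk, Nat.cast_add, add_assoc] }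
  have hT : ∏ i, MvPolynomial.X i ^ (v i : ℕ) ∈ T :=
    T.prod_mem fun i _ => T.pow_mem ⟨1, fun j m => by
      rw [incl_X, Nat.cast_one]
      exact G.proj_letter (some i) j m⟩ _
  obtain ⟨k, hk⟩ := hT
  refine ⟨k, fun i m => ?_⟩
  rw [xf, mul_smul, mul_smul, add_right_comm, hk]
  congr 1
  exact G.proj_letter none i m

/-- The homogeneous components of the elements of a finite set form a finite set of homogeneous
elements. -/
theorem exists_homogeneous (s : Finset M) : ∃ (t : Finset M) (d : M → ℤ),
    (∀ h ∈ t, ∃ m ∈ s, ∃ i, h = G.proj i m) ∧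
    (∀ h ∈ t, ∀ i, G.proj i h = if i = d h then h else 0) ∧
    ∀ m ∈ s, ∀ i, G.proj i m ∈ Submodule.span (A p n) (t : Set M) := by
  classical
  let t : Finset M := s.biUnion fun m => (G.finite_support m).toFinset.image fun i => G.proj i m
  -- The degree function is total on `M`, so elements outside `t` get the dummy degree `0`.
  have h1 : ∀ h : M, ∃ i, h ∈ t → ∃ m ∈ s, h = G.proj i m := fun h => by
    by_cases ht : h ∈ t
    · obtain ⟨m, hm, h'⟩ := Finset.mem_biUnion.1 ht
      obtain ⟨i, -, rfl⟩ := Finset.mem_image.1 h'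
      exact ⟨i, fun _ => ⟨m, hm, rfl⟩⟩
    · exact ⟨0, fun h' => absurd h' ht⟩
  choose d hd using h1
  refine ⟨t, d, fun h hh => ?_, fun h hh i => ?_, fun m hm i => ?_⟩
  · obtain ⟨m, hm, h'⟩ := hd h hh
    exact ⟨m, hm, _, h'⟩
  · obtain ⟨m, hm, h'⟩ := hd h hh
    generalize d h = e at h' ⊢
    subst h'
    exact G.proj_proj _ _ _
  · by_cases h0 : G.proj i m = 0
    · rw [h0]
      exact Submodule.zero_mem _
    · exact Submodule.subset_span (Finset.mem_biUnion.2
        ⟨m, hm, Finset.mem_image.2 ⟨i, by simpa using h0, rfl⟩⟩)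

variable [Module (ZMod p) M] [IsScalarTower (ZMod p) (A p n) M]

theorem proj_smul {h : M} {d : ℤ} (hh : ∀ i, G.proj i h = if i = d then h else 0) (i : ℤ)
    (a : A p n) : G.proj i (a • h) = projA p n (i - d) a • h := by
  induction a using A_induction generalizing i with
  | one =>
    rw [one_smul, hh, projA_one]
    simp only [sub_eq_zero]
    split_ifs <;> simp
  | letter_mul l a ha =>
    have := G.proj_letter l (i - 1) (a • h)
    rw [sub_add_cancel, ha] at this
    rw [mul_smul, this, projA_letter_mul', mul_smul, sub_right_comm]
  | add a b ha hb => rw [add_smul, map_add, ha, hb, map_add, add_smul]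
  | smul c a ha => rw [smul_assoc, ZMod.map_smul, ha, projA_smul, smul_assoc]

theorem proj_mem_span {s : Set M} {d : M → ℤ}
    (hs : ∀ h ∈ s, ∀ i, G.proj i h = if i = d h then h else 0) {m : M}
    (hm : m ∈ Submodule.span (A p n) s) (i : ℤ) : G.proj i m ∈ Submodule.span (A p n) s := by
  induction hm using Submodule.closure_induction with
  | zero => rw [map_zero]; exact Submodule.zero_mem _
  | add a b _ _ ha hb => rw [map_add]; exact Submodule.add_mem _ ha hb
  | smul_mem a h hh =>
    rw [G.proj_smul (hs h hh)]
    exact Submodule.smul_mem _ _ (Submodule.subset_span hh)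

/-- Graded Nakayama: modulo the span of the lifted generators, each element of `L` is a combination
of `x^v f g` with `g ∈ L`. Its degree `i` component therefore involves only components of such `g`
in degrees below `i`, and induction starts at the lower bound `d`. -/
theorem fg_of_cokerSub_fg {d : ℤ} (hd : ∀ i < d, ∀ m, G.proj i m = 0) {L : Submodule (A p n) M}
    (hL : ∀ m ∈ L, ∀ i, G.proj i m ∈ L) (h : (cokerSub L).FG) : L.FG := by
  obtain ⟨s, hsL, hs⟩ := exists_finite_of_cokerSub_fg h
  obtain ⟨t, e, hts, ht, hst⟩ := G.exists_homogeneous s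
  refine ⟨t, le_antisymm (Submodule.span_le.2 fun h hh => ?_) fun m hm => ?_⟩
  · obtain ⟨m, hm, i, rfl⟩ := hts h hh
    exact hL m (hsL m hm) i
  have hle : Submodule.span (A p n) (s : Set M) ≤ Submodule.span (A p n) t :=
    Submodule.span_le.2 fun m hm => G.mem_of_forall_proj_mem (hst m hm)
  suffices H : ∀ (k : ℕ) (m : M), m ∈ L → ∀ i < d + k,
      G.proj i m ∈ Submodule.span (A p n) (t : Set M) from
    G.mem_of_forall_proj_mem fun i => H (i - d + 1).toNat m hm i (by omega)
  intro k
  induction k with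
  | zero =>
    intro m _ i hi
    rw [hd i (by simpa using hi)]
    exact Submodule.zero_mem _
  | succ k ih =>
    intro m hm i hi
    obtain ⟨u, hu, φ, hφ, rfl⟩ := hs m hm
    rw [map_add, map_sum]
    refine Submodule.add_mem _ (G.proj_mem_span ht (hle hu) i) (Submodule.sum_mem _ fun v _ => ?_)
    obtain ⟨k', hk'⟩ := G.exists_proj_xf_smul v
    have := hk' (i - k' - 1) (φ v)
    rw [show i - k' - 1 + k' + 1 = i by ring] at this
    rw [this]
    exact Submodule.smul_mem _ _ (ih _ (hφ v) _ (by push_cast at hi; omega))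

end Projections

/-- The projections of a graded module. -/
noncomputable def IsGradedModule.projections {p n : ℕ} {N : Type*} [AddCommGroup N]
    [Module (ZMod p) N] [Module (A p n) N] {𝒩 : ℤ → Submodule (ZMod p) N}
    (h : IsGradedModule p n 𝒩) : Projections p n N :=
  letI := h.isInternal.chooseDecomposition
  { proj := fun i =>
      { toFun := fun m => DirectSum.decompose 𝒩 m i
        map_zero' := by simp
        map_add' := fun a b => by simp }
    exists_sum_eq := fun m => by
      classical
      refine ⟨(DirectSum.decompose 𝒩 m).support, fun t ht => ?_⟩
      refine Eq.trans ?_ (DirectSum.sum_support_decompose 𝒩 m)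
      refine (Finset.sum_subset ht fun i _ hi => ?_).symm
      simpa using hi
    proj_proj := fun i j m => by
      change ((DirectSum.decompose 𝒩 (DirectSum.decompose 𝒩 m j : N) i : 𝒩 i) : N) = _
      rw [DirectSum.decompose_coe]
      split_ifs with hij
      · subst hij
        rw [DirectSum.of_eq_same]
        rfl
      · rw [DirectSum.of_eq_of_ne _ _ _ hij]
        rfl
    proj_letter := fun l i m => by
      change ((DirectSum.decompose 𝒩 (letter p n l • m) (i + 1) : 𝒩 (i + 1)) : N) =
        letter p n l • (DirectSum.decompose 𝒩 m i : N)
      induction m using DirectSum.Decomposition.inductionOn 𝒩 with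
      | zero => simp
      | @homogeneous j m =>
        have hm : letter p n l • (m : N) ∈ 𝒩 (j + 1) := by
          have := h.smul_mem 1 j (letter p n l) (Submodule.subset_span ⟨[l], rfl, by simp⟩) m m.2
          rwa [Nat.cast_one, add_comm] at this
        rcases eq_or_ne i j with rfl | hij
        · rw [DirectSum.decompose_of_mem_same 𝒩 hm, DirectSum.decompose_of_mem_same 𝒩 m.2]
        · rw [DirectSum.decompose_of_mem_ne 𝒩 hm (by simpa using hij.symm),
            DirectSum.decompose_of_mem_ne 𝒩 m.2 hij.symm, smul_zero]
      | add a b ha hb => simp [smul_add, ha, hb] }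

theorem IsGradedModule.proj_mem {p n : ℕ} {N : Type*} [AddCommGroup N]
    [Module (ZMod p) N] [Module (A p n) N] {𝒩 : ℤ → Submodule (ZMod p) N}
    (h : IsGradedModule p n 𝒩) (i : ℤ) (m : N) : h.projections.proj i m ∈ 𝒩 i :=
  letI := h.isInternal.chooseDecomposition
  (DirectSum.decompose 𝒩 m i).2

/-! ### Finite presentation and finite length -/

section Main

variable {p n : ℕ} {N : Type*} [AddCommGroup N] [Module (ZMod p) N] [Module (A p n) N]
  [IsScalarTower (ZMod p) (A p n) N]

/-- Homogeneous generators give a degree-preserving free cover, so its kernel is stable under the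
projections and graded Nakayama applies to it. -/
theorem Projections.finitePresentation (G : Projections p n N) {d : ℤ} [NeZero p]
    [IsNoetherianRing (R p n)] (hd : ∀ i < d, ∀ m, G.proj i m = 0)
    (hN : Module.Finite (A p n) N) (hK : (LinearMap.ker (theta p n N)).FG) :
    Module.FinitePresentation (A p n) N := by
  obtain ⟨s, hs⟩ := hN.fg_top
  obtain ⟨t, e, -, ht, hst⟩ := G.exists_homogeneous s
  have hspan : Submodule.span (A p n) (t : Set N) = ⊤ := by
    rw [eq_top_iff, ← hs]
    exact Submodule.span_le.2 fun m hm => G.mem_of_forall_proj_mem (hst m hm)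
  let l : (t → A p n) →ₗ[A p n] N := Fintype.linearCombination (A p n) (Subtype.val : t → N)
  have hl : Function.Surjective l := by
    rw [← LinearMap.range_eq_top, Fintype.range_linearCombination, Subtype.range_coe]
    exact hspan
  -- A generator with `e j < d` vanishes, so its basis vector may have any degree; `max d (e j)`
  -- keeps the free module zero below `d`.
  have hproj (i : ℤ) (a : t → A p n) :
      G.proj i (l a) = l ((projectionsPi fun j : t => max d (e j)).proj i a) := by
    simp only [l, Fintype.linearCombination_apply, map_sum]
    refine Finset.sum_congr rfl fun j _ => ?_
    refine G.proj_smul (fun i => ?_) i (a j)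
    rw [ht j j.2]
    rcases le_or_gt d (e j) with hj | hj
    · simp [max_eq_right hj]
    · have : (j : N) = 0 := by
        rw [← hd _ hj j, ht j j.2, if_pos rfl]
      simp [this]
  refine Module.finitePresentation_of_free_of_surjective l hl ?_
  refine (projectionsPi fun j : t => max d (e j)).fg_of_cokerSub_fg (d := d)
    (fun i hi a => funext fun j => projA_of_neg (sub_neg.2 (hi.trans_le (le_max_left d (e j)))) _)
    (fun a ha i => ?_) (cokerSub_ker_fg hl hK)
  rw [LinearMap.mem_ker] at ha ⊢
  rw [← hproj, ha, map_zero]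

theorem isFiniteLength_K [NeZero p] (h : Module.Finite (R p n) (K p n N)) :
    IsFiniteLength (R p n) (K p n N) := by
  have : Finite (K p n N) := finite_of_fg_FA (Module.Finite.iff_fg.1 h)
  exact isFiniteLength_iff_isNoetherian_isArtinian.2 ⟨inferInstance, inferInstance⟩

theorem finite_K_of_finitePresentation [NeZero p] [IsNoetherianRing (R p n)]
    [Module.FinitePresentation (A p n) N] : Module.Finite (R p n) (K p n N) := by
  obtain ⟨m, l, hl⟩ := Module.Finite.exists_fin' (A p n) N
  exact Module.Finite.iff_fg.2 (ker_theta_fg hl (thetaAux_pi_injective (Fin m))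
    (Module.FinitePresentation.fg_ker l hl))

end Main

end FrobGraded

theorem theorem3p19 (p n : ℕ) [Fact p.Prime]
    (N : Type*) [AddCommGroup N] [Module (ZMod p) N] [Module (FrobGraded.A p n) N]
    [IsScalarTower (ZMod p) (FrobGraded.A p n) N] :
    (Module.Finite (FrobGraded.A p n) N →
      Module.Finite (FrobGraded.R p n) (FrobGraded.C p n N)) ∧
    (Module.FinitePresentation (FrobGraded.A p n) N →
      IsFiniteLength (FrobGraded.R p n) (FrobGraded.K p n N)) ∧
    ∀ 𝒩 : ℤ → Submodule (ZMod p) N, FrobGraded.IsGradedModule p n 𝒩 →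
      (∀ i, Module.Finite (ZMod p) (𝒩 i)) → (∃ d : ℤ, ∀ i < d, 𝒩 i = ⊥) →
        (Module.Finite (FrobGraded.A p n) N ↔
          Module.Finite (FrobGraded.R p n) (FrobGraded.C p n N)) ∧
        (Module.FinitePresentation (FrobGraded.A p n) N ↔
          Module.Finite (FrobGraded.R p n) (FrobGraded.C p n N) ∧
            IsFiniteLength (FrobGraded.R p n) (FrobGraded.K p n N)) ∧
        (Module.FinitePresentation (FrobGraded.A p n) N ↔
          Module.Finite (FrobGraded.R p n) (FrobGraded.C p n N) ∧
            Module.Finite (FrobGraded.R p n) (FrobGraded.K p n N)) := by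
  have h1 (h : Module.Finite (FrobGraded.A p n) N) :
      Module.Finite (FrobGraded.R p n) (FrobGraded.C p n N) :=
    FrobGraded.cokerSub_top_fg_iff.1 (FrobGraded.cokerSub_fg h.fg_top)
  have h2 (h : Module.FinitePresentation (FrobGraded.A p n) N) :
      Module.Finite (FrobGraded.R p n) (FrobGraded.K p n N) :=
    FrobGraded.finite_K_of_finitePresentation
  refine ⟨h1, fun h => FrobGraded.isFiniteLength_K (h2 h), fun 𝒩 h𝒩 _ ⟨d, hd⟩ => ?_⟩
  have hd' : ∀ i < d, ∀ m, h𝒩.projections.proj i m = 0 := fun i hi m => by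
    simpa [hd i hi] using h𝒩.proj_mem i m
  have h3 (h : Module.Finite (FrobGraded.R p n) (FrobGraded.C p n N)) :
      Module.Finite (FrobGraded.A p n) N :=
    -- Graded Nakayama for `L = ⊤`, whose cokernel is `C_N`.
    ⟨h𝒩.projections.fg_of_cokerSub_fg hd' (fun _ _ _ => trivial)
      (FrobGraded.cokerSub_top_fg_iff.2 h)⟩
  have h4 (hC : Module.Finite (FrobGraded.R p n) (FrobGraded.C p n N))
      (hK : Module.Finite (FrobGraded.R p n) (FrobGraded.K p n N)) :
      Module.FinitePresentation (FrobGraded.A p n) N :=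
    h𝒩.projections.finitePresentation hd' (h3 hC) (Module.Finite.iff_fg.1 hK)
  refine ⟨⟨h1, h3⟩, ⟨fun h => ⟨h1 inferInstance, FrobGraded.isFiniteLength_K (h2 h)⟩,
    fun h => h4 h.1 ?_⟩, ⟨fun h => ⟨h1 inferInstance, h2 h⟩, fun h => h4 h.1 h.2⟩⟩
  have := (isFiniteLength_iff_isNoetherian_isArtinian.1 h.2).1
  infer_instance
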